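/- Let $N$ be a finite set of item types and $M$ a finite nonempty set of bidders. Item type $i\in N$ is supplied in $u(i)\ge 1$ units ($u\in\mathbb Z^N$), and $[\mathbf 0,u]_{\mathbb Z}=\{x\in\mathbb Z^N : \mathbf 0\le x\le u\}$ is the set of bundles. Each bidder $b\in M$ has a valuation $v_b:[\mathbf 0,u]_{\mathbb Z}\to\mathbb Z$ that is monotone nondecreasing with $v_b(\mathbf 0)=0$ and M$^\natural$-concave: for all $x,y\in[\mathbf 0,u]_{\mathbb Z}$ and every $i$ with $x(i)>y(i)$ there is $k$, either $k=0$ (with $\chi_0=\mathbf 0$) or $k\in N$ with $x(k)<y(k)$, such that $v_b(x)+v_b(y)\le v_b(x-\chi_i+\chi_k)+v_b(y+\chi_i-\chi_k)$. For a price vector $p\in\mathbb Z_{\ge 0}^N$ let $D_b(p)=\arg\max\{v_b(x)-p^\top x : x\in[\mathbf 0,u]_{\mathbb Z}\}$. Call $p$ an equilibrium price vector if there are bundles $x_b\in D_b(p)$ $(b\in M)$ with $\sum_{b\in M} x_b=u$. For $X\subseteq N$ put $u(X)=\sum_{i\in X}u(i)$, $\mu_b(X;p)=\min\{\sum_{i\in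 X}y(i) : y\in D_b(p)\}$ and $\delta(X;p)=\sum_{b\in M}\mu_b(X;p)-u(X)$; call $X$ overdemanded at $p$ if $\sum_{b\in M}\mu_b(X;p)>u(X)$. **Theorem.** For every $p\in\mathbb Z_{\ge0}^N$ there is a unique inclusion-minimal maximizer of $X\mapsto\delta(X;p)$, and the set of equilibrium price vectors has a least element $\underline p$ (the unique minimal equilibrium price vector). Consider the algorithm Ascending Auction: start with any $p:=p^\circ\in\mathbb Z_{\ge0}^N$ with $p^\circ\le\underline p$; as long as some set is overdemanded at $p$, select an overdemanded set $X$ and replace $p$ by $p+\chi_X$; stop when no set is overdemanded at $p$. Suppose that in each iteration the selected set $X$ is (i) an inclusion-minimal overdemanded set at $p$, or (ii) the unique inclusion-minimal maximizer of $\delta(\,\cdot\,;p)$. Then such a selection is possible in every iteration, and, however the selections are made, the algorithm stops after finitely many iterations with $p=\underline p$. This holds if rule (i) is used in all iterations, if rule (ii) is used in all iterations, and if the choice between (i) and (ii) may vary from one iteration to the next. -/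

import Mathlib

/-! Vectors indexed by the finite set `N` of item types are functions `N → ℤ`; bidders are the
elements of the finite type `M`.  A valuation is a function `(N → ℤ) → ℤ` of which only the values
on the box `[0, u] = Set.Icc 0 u` are ever used. -/

namespace MultiDemand

variable {N M : Type*}

/-- The total `z(X) = ∑_{i ∈ X} z(i)` of a vector over a set of items. -/
def total (z : N → ℤ) (X : Finset N) : ℤ := ∑ i ∈ X, z i

/-- The characteristic vector of a set of items. -/
noncomputable def chi (X : Finset N) : N → ℤ := Set.indicator (X : Set N) 1

/-- The exchange axiom defining M♮-concave functions on the box `[0, u]`.  The first alternative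
is the choice `k = 0` (with `χ_0 = 0`), the second one `k ∈ supp⁻(x - y)`. -/
def MnatConcave [DecidableEq N] (u : N → ℤ) (f : (N → ℤ) → ℤ) : Prop :=
  ∀ x ∈ Set.Icc 0 u, ∀ y ∈ Set.Icc 0 u, ∀ i, 0 < (x - y) i →
    f x + f y ≤ f (x - Pi.single i 1) + f (y + Pi.single i 1) ∨
    ∃ k, (x - y) k < 0 ∧
      f x + f y ≤
        f (x - Pi.single i 1 + Pi.single k 1) + f (y + Pi.single i 1 - Pi.single k 1)

variable [Fintype N]

/-- The demand set `argmax {f x - pᵀ x | x ∈ [0, u]}` of a bidder with valuation `f`. -/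
def demand (u : N → ℤ) (f : (N → ℤ) → ℤ) (p : N → ℤ) : Set (N → ℤ) :=
  {x | x ∈ Set.Icc 0 u ∧ ∀ y ∈ Set.Icc 0 u, f y - p ⬝ᵥ y ≤ f x - p ⬝ᵥ x}

/-- `μ(X; p) = min {y(X) | y ∈ D(p)}`. -/
noncomputable def mu (u : N → ℤ) (f : (N → ℤ) → ℤ) (p : N → ℤ) (X : Finset N) : ℤ :=
  sInf ((fun y => total y X) '' demand u f p)

/-- The infimum defining `mu` is a minimum. -/
theorem mu_isLeast {u : N → ℤ} (hu : 0 ≤ u) (f : (N → ℤ) → ℤ) (p : N → ℤ) (X : Finset N) :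
    IsLeast ((fun y => total y X) '' demand u f p) (mu u f p X) := by
  classical
  obtain ⟨x, hx, hmax⟩ := (Set.finite_Icc (0 : N → ℤ) u).exists_maximalFor
    (fun x => f x - p ⬝ᵥ x) _ ⟨0, Set.left_mem_Icc.2 hu⟩
  have hne : ((fun y => total y X) '' demand u f p).Nonempty := by
    refine ⟨_, x, ⟨hx, fun y hy => ?_⟩, rfl⟩
    rcases le_total (f y - p ⬝ᵥ y) (f x - p ⬝ᵥ x) with h | h
    · exact h
    · exact hmax hy h
  have hbdd : BddBelow ((fun y => total y X) '' demand u f p) := by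
    refine ⟨0, ?_⟩
    rintro _ ⟨y, hy, rfl⟩
    exact Finset.sum_nonneg fun i _ => hy.1.1 i
  exact ⟨Int.csInf_mem hne hbdd, fun a ha => csInf_le hbdd ha⟩

variable [Fintype M]

/-- `p` is an equilibrium price vector: it is nonnegative and some allocation of all the units
gives every bidder a bundle in his demand set. -/
def IsEquilibriumPrice (u : N → ℤ) (v : M → (N → ℤ) → ℤ) (p : N → ℤ) : Prop :=
  0 ≤ p ∧ ∃ x : M → N → ℤ, ∑ b, x b = u ∧ ∀ b, x b ∈ demand u (v b) p

/-- The deficiency `δ(X; p) = ∑_b μ_b(X; p) - u(X)`. -/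
noncomputable def deficiency (u : N → ℤ) (v : M → (N → ℤ) → ℤ) (p : N → ℤ) (X : Finset N) : ℤ :=
  ∑ b, mu u (v b) p X - total u X

/-- `X` is overdemanded at `p`. -/
def Overdemanded (u : N → ℤ) (v : M → (N → ℤ) → ℤ) (p : N → ℤ) (X : Finset N) : Prop :=
  total u X < ∑ b, mu u (v b) p X

/-- `X` is an inclusion-minimal overdemanded set at `p`. -/
def MinimalOverdemanded (u : N → ℤ) (v : M → (N → ℤ) → ℤ) (p : N → ℤ) (X : Finset N) : Prop :=
  Minimal (Overdemanded u v p) X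

/-- `X` is an inclusion-minimal maximizer of the deficiency at `p`. -/
def MinimalMaximizer (u : N → ℤ) (v : M → (N → ℤ) → ℤ) (p : N → ℤ) (X : Finset N) : Prop :=
  Minimal (fun Y => ∀ Z, deficiency u v p Z ≤ deficiency u v p Y) X

/-- One iteration of the ascending auction from `p` to `q`, where an overdemanded set `X` obeying
the selection rule `rule p X` is selected and the prices in `X` are raised by one. -/
def AuctionStep (u : N → ℤ) (v : M → (N → ℤ) → ℤ) (rule : (N → ℤ) → Finset N → Prop)
    (p q : N → ℤ) : Prop :=
  ∃ X, Overdemanded u v p X ∧ rule p X ∧ q = p + chi X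

/-- The ascending auction that starts at `p₀` and selects sets according to `rule` finds `r`:
however the selections are made, it does not run forever; whenever an overdemanded set exists at
the current price vector, one obeying the rule can be selected; and if the auction stops, because
no overdemanded set exists, then the current price vector is `r`. -/
def AuctionFinds (u : N → ℤ) (v : M → (N → ℤ) → ℤ) (rule : (N → ℤ) → Finset N → Prop)
    (p₀ r : N → ℤ) : Prop :=
  (¬ ∃ s : ℕ → N → ℤ, s 0 = p₀ ∧ ∀ t, AuctionStep u v rule (s t) (s (t + 1))) ∧
  ∀ q, Relation.ReflTransGen (AuctionStep u v rule) p₀ q →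
    ((∃ X, Overdemanded u v q X) → ∃ X, Overdemanded u v q X ∧ rule q X) ∧
    ((¬ ∃ X, Overdemanded u v q X) → q = r)

end MultiDemand

/-!
The auction is a steepest descent method for the Lyapunov function `L(p) = ∑_b V_b(p) + pᵀ u`,
where `V_b` is the indirect utility of bidder `b`.

The basic observation concerns bundles `x ∈ D(p)` and `y ∈ D(q)` of one bidder that are nearest to
each other in the `ℓ¹` norm.  An exchange step between them yields a nearer pair, so that it leaves
both demand sets, and by integrality it costs at least `2`; as the valuations do not drop in total,
this bounds the price difference `p - q` along the step (`MnatConcave.exists_nearest`).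
Hence there is a common demanded bundle at `p` and `q` if `p ≤ q ≤ p + 1`
(`MnatConcave.exists_mem_demand_inter`), which gives
`L(p + χ_X) = L(p) - δ(X; p)` and the submodularity of `L`, first locally and then globally
(`lyapunov_submodular`).  It also gives enough of the translation submodularity of `L` to see that
`p` minimizes `L` on `{q | p ≤ q}` as soon as no set is overdemanded at `p`
(`lyapunov_le_of_forall_le_add_chi`).

The equilibrium price vectors are the nonnegative minimizers of `L` (`isEquilibriumPrice_iff`):
the aggregate demand at `p` is a Minkowski sum of sets with the exchange property, hence has this
property itself (`IsExchangeSet.sum`), and so contains `u` unless some set of items separates `u`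
from it (`IsExchangeSet.mem_of_forall_total`), in which case `L` decreases from `p` to `p ± χ_X`.
By monotonicity of the valuations negative prices can be raised to zero without increasing `L`, so
that equilibria exist, and by submodularity there is a least one, `r`.

If `p ≤ r` and `X` is selected at `p`, submodularity for `p + χ_X` and `r` shows that the items of
`X` with `p i < r i` alone have at least the deficiency of `X`; by the minimality of `X` these are
all items of `X`, and `p + χ_X ≤ r`.  When the auction stops, `p ≤ r` minimizes `L` on
`{q | p ≤ q}`, hence globally, and `p = r`.  It stops because `L` is bounded below and drops in
every iteration.
-/

namespace MultiDemand

variable {N M : Type*}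

/-! ### Exchange steps and the `ℓ¹` norm -/

/-- The step `d = χ_i - χ_k` by which the exchange axiom moves `x` to `x - d` and `y` to `y + d`,
where `z = x - y` and either `k = 0` (so that `d = χ_i`) or `z k < 0`. -/
def IsStep [DecidableEq N] (z : N → ℤ) (i : N) (d : N → ℤ) : Prop :=
  d = Pi.single i 1 ∨ ∃ k, z k < 0 ∧ d = Pi.single i 1 - Pi.single k 1

/-- The `ℓ¹` norm of an integer vector, as a natural number. -/
def l1 [Fintype N] (z : N → ℤ) : ℕ := ∑ i, (z i).natAbs

theorem l1_neg [Fintype N] (z : N → ℤ) : l1 (-z) = l1 z := by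
  simp [l1]

theorem IsStep.natAbs_le [DecidableEq N] {z d : N → ℤ} {i : N} (h : IsStep z i d)
    (hi : 0 < z i) (j : N) : ((z - d) j).natAbs ≤ (z j).natAbs := by
  rcases h with rfl | ⟨k, hk, rfl⟩
  · by_cases hj : j = i
    · subst hj; simp; omega
    · simp [hj]
  · have hki : k ≠ i := by rintro rfl; omega
    by_cases hj : j = i
    · subst hj; simp [hki.symm]; omega
    · by_cases hj' : j = k
      · subst hj'; simp [hj]; omega
      · simp [hj, hj']

theorem IsStep.apply_self [DecidableEq N] {z d : N → ℤ} {i : N} (h : IsStep z i d)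
    (hi : 0 < z i) : d i = 1 := by
  rcases h with rfl | ⟨k, hk, rfl⟩
  · simp
  · have hki : i ≠ k := by rintro rfl; omega
    simp [hki]

theorem IsStep.l1_lt [Fintype N] [DecidableEq N] {z d : N → ℤ} {i : N} (h : IsStep z i d)
    (hi : 0 < z i) : l1 (z - d) < l1 z := by
  refine Finset.sum_lt_sum (fun j _ => h.natAbs_le hi j) ⟨i, Finset.mem_univ i, ?_⟩
  have := h.apply_self hi
  simp only [Pi.sub_apply]
  omega

/-- An exchange step keeps both points in every box that contains them. -/
theorem IsStep.mem_Icc [DecidableEq N] {u x y d : N → ℤ} {i : N} (h : IsStep (x - y) i d)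
    (hi : 0 < (x - y) i) (hx : x ∈ Set.Icc 0 u) (hy : y ∈ Set.Icc 0 u) :
    x - d ∈ Set.Icc 0 u ∧ y + d ∈ Set.Icc 0 u := by
  have key : ∀ j, d j = 0 ∨ (0 ≤ d j ∧ d j ≤ x j - y j) ∨ (d j ≤ 0 ∧ x j - y j ≤ d j) := by
    intro j
    simp only [Pi.sub_apply] at hi
    rcases h with rfl | ⟨k, hk, rfl⟩
    · by_cases hj : j = i
      · subst hj; simp; omega
      · simp [hj]
    · simp only [Pi.sub_apply] at hk
      have hki : k ≠ i := by rintro rfl; omega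
      by_cases hj : j = i
      · subst hj; simp [hki.symm]; omega
      · by_cases hj' : j = k
        · subst hj'; simp [hj]; omega
        · simp [hj, hj']
  refine ⟨⟨fun j => ?_, fun j => ?_⟩, ⟨fun j => ?_, fun j => ?_⟩⟩ <;>
  · have h1 := hx.1 j
    have h2 : x j ≤ u j := hx.2 j
    have h3 := hy.1 j
    have h4 : y j ≤ u j := hy.2 j
    have h5 := key j
    simp only [Pi.zero_apply, Pi.sub_apply, Pi.add_apply] at h1 h3 ⊢
    omega

theorem MnatConcave.exists_step [DecidableEq N] {u : N → ℤ} {f : (N → ℤ) → ℤ}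
    (hf : MnatConcave u f) {x y : N → ℤ} (hx : x ∈ Set.Icc 0 u) (hy : y ∈ Set.Icc 0 u) {i : N}
    (hi : 0 < (x - y) i) : ∃ d, IsStep (x - y) i d ∧ f x + f y ≤ f (x - d) + f (y + d) := by
  rcases hf x hx y hy i hi with h | ⟨k, hk, h⟩
  · exact ⟨_, Or.inl rfl, h⟩
  · refine ⟨_, Or.inr ⟨k, hk, rfl⟩, ?_⟩
    rwa [← sub_add, ← add_sub_assoc]

theorem chi_apply [DecidableEq N] (X : Finset N) (i : N) :
    chi X i = if i ∈ X then 1 else 0 := by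
  simp [chi, Set.indicator_apply]

theorem chi_dotProduct [Fintype N] (X : Finset N) (x : N → ℤ) : chi X ⬝ᵥ x = total x X := by
  classical
  simp [dotProduct, chi_apply, total]

theorem chi_nonneg (X : Finset N) : 0 ≤ chi X := by
  classical
  intro i
  rw [chi_apply]
  split_ifs <;> simp

theorem chi_le_one (X : Finset N) : chi X ≤ 1 := by
  classical
  intro i
  rw [chi_apply]
  split_ifs <;> simp

theorem total_sum [Fintype M] (x : M → N → ℤ) (X : Finset N) :
    total (∑ b, x b) X = ∑ b, total (x b) X := by
  simp only [total, Finset.sum_apply]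
  exact Finset.sum_comm

/-! ### Sets with the exchange property -/

/-- The one-sided exchange property of M♮-convex sets of integer vectors: if `y i < x i`, then `x`
can be moved towards `y` by a step that lowers its `i`-th entry.  Unlike the simultaneous exchange
of `x` and `y`, this property is easily seen to pass to Minkowski sums. -/
def IsExchangeSet [DecidableEq N] (S : Set (N → ℤ)) : Prop :=
  ∀ x ∈ S, ∀ y ∈ S, ∀ i, 0 < (x - y) i → ∃ d, IsStep (x - y) i d ∧ x - d ∈ S

/-- The Minkowski sum of exchange sets is an exchange set.  An exchange in one summand that moves a
unit of item `i` to an item `k` not in deficit in the sum creates a surplus of `k` in some summand,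
where the exchange is continued from `k`; the total `ℓ¹` distance between the summands drops with
every exchange, so that this comes to an end. -/
theorem IsExchangeSet.sum [Fintype N] [DecidableEq N] [Fintype M] {T : M → Set (N → ℤ)}
    (hT : ∀ b, IsExchangeSet (T b)) :
    IsExchangeSet {w | ∃ x : M → N → ℤ, ∑ b, x b = w ∧ ∀ b, x b ∈ T b} := by
  classical
  rintro w ⟨x₀, hx₀, hxT₀⟩ z ⟨y, hys, hy⟩ i hi
  -- `k` is the item that currently carries the unit taken from `i`
  have walk : ∀ n : ℕ, ∀ (x : M → N → ℤ) (k : N), ∑ b, l1 (x b - y b) = n →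
      (∀ b, x b ∈ T b) → ∑ b, x b = w - Pi.single i 1 + Pi.single k 1 → 0 ≤ (w - z) k →
      ∃ d, IsStep (w - z) i d ∧
        w - d ∈ {w | ∃ x : M → N → ℤ, ∑ b, x b = w ∧ ∀ b, x b ∈ T b} := by
    intro n
    induction n using Nat.strong_induction_on with
    | _ n ih =>
    intro x k hn hx hxs hk
    have hlt : ∑ b, y b k < ∑ b, x b k := by
      have h1 := congrFun hxs k
      have h2 := congrFun hys k
      rw [Finset.sum_apply] at h1 h2
      rw [h1, h2]
      simp only [Pi.sub_apply] at hi hk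
      by_cases hki : k = i
      · subst hki; simpa using hi
      · simp [hki]; omega
    obtain ⟨b, -, hb⟩ := Finset.exists_lt_of_sum_lt hlt
    have hb' : 0 < (x b - y b) k := by simpa using hb
    obtain ⟨d, hd, hxd⟩ := hT b (x b) (hx b) (y b) (hy b) k hb'
    set x' : M → N → ℤ := x - Pi.single b d
    have hxb : x' b = x b - d := by simp [x']
    have hxc : ∀ c, c ≠ b → x' c = x c := fun c hc => by simp [x', hc]
    have hx' : ∀ c, x' c ∈ T c := by
      intro c
      by_cases hc : c = b
      · subst hc; rwa [hxb]
      · rw [hxc c hc]; exact hx c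
    have hsx : ∑ c, x' c = w - Pi.single i 1 + Pi.single k 1 - d := by
      simp [x', Finset.sum_sub_distrib, hxs]
    have hdec : ∑ c, l1 (x' c - y c) < n := by
      have hb₁ : l1 (x' b - y b) < l1 (x b - y b) := by
        rw [hxb, sub_right_comm]
        exact hd.l1_lt hb'
      rw [← hn]
      refine Finset.sum_lt_sum (fun c _ => ?_) ⟨b, Finset.mem_univ b, hb₁⟩
      by_cases hc : c = b
      · subst hc; exact hb₁.le
      · rw [hxc c hc]
    rcases hd with rfl | ⟨l, -, rfl⟩
    · refine ⟨Pi.single i 1, Or.inl rfl, x', ?_, hx'⟩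
      rw [hsx]; abel
    · by_cases hl : (w - z) l < 0
      · refine ⟨Pi.single i 1 - Pi.single l 1, Or.inr ⟨l, hl, rfl⟩, x', ?_, hx'⟩
        rw [hsx]; abel
      · refine ih _ hdec x' l rfl hx' ?_ (not_lt.1 hl)
        rw [hsx]; abel
  refine walk _ x₀ i rfl hxT₀ ?_ hi.le
  rw [hx₀]; abel

/-- If on no set of items all points of the exchange set `S` have a larger total than `u`, then a
point `y` of `S` that is nearest to `u` satisfies `y ≤ u`.  Otherwise `u i < y i` for some `i`, and
on the set `R` of items that a unit of `i` can be exchanged for, `y` has the least total in `S`,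
whereas the total of `u` is smaller still. -/
theorem IsExchangeSet.le_of_nearest [Fintype N] [DecidableEq N] {S : Set (N → ℤ)}
    (hS : IsExchangeSet S) {u y : N → ℤ} (hy : y ∈ S)
    (hnear : ∀ z ∈ S, l1 (y - u) ≤ l1 (z - u))
    (hX : ∀ X : Finset N, ∃ z ∈ S, total z X ≤ total u X) : y ≤ u := by
  classical
  intro i
  by_contra! hi
  have hi' : 0 < (y - u) i := by simpa using hi
  have hno : ∀ d, IsStep (y - u) i d → y - d ∉ S := fun d hd hdS => by
    have h1 := hnear _ hdS
    have h2 := hd.l1_lt hi'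
    rw [sub_right_comm] at h1
    omega
  have hno' : y - Pi.single i 1 ∉ S := hno _ (Or.inl rfl)
  set R : Finset N := Finset.univ.filter fun k => y - Pi.single i 1 + Pi.single k 1 ∈ S with hR
  have memR : ∀ k, k ∈ R ↔ y - Pi.single i 1 + Pi.single k 1 ∈ S := fun k => by simp [hR]
  have hRi : i ∈ R := by rw [memR]; simpa using hy
  have hRu : ∀ k ∈ R, u k ≤ y k := by
    intro k hk
    by_contra! hlt
    refine hno _ (Or.inr ⟨k, by simpa using hlt, rfl⟩) ?_
    rw [← sub_add]
    exact (memR k).1 hk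
  -- a unit of an item of `R` can be exchanged only for another item of `R`, and not for nothing
  have trans : ∀ j ∈ R, ∀ z d, 0 < (y - z) j → IsStep (y - z) j d → y - d ∈ S →
      ∃ m ∈ R, d = Pi.single j 1 - Pi.single m 1 := by
    intro j hj z d hzj hd hdS
    by_cases hji : j = i
    · subst hji
      rcases hd with rfl | ⟨m, hm, rfl⟩
      · exact absurd hdS hno'
      · exact ⟨m, by rw [memR, sub_add]; exact hdS, rfl⟩
    rcases hd with rfl | ⟨m, hm, rfl⟩
    · -- moving `y - χ_j` towards `y - χ_i + χ_j`, and then `y` towards `y - χ_i - χ_j`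
      have hc : y - Pi.single j 1 - Pi.single i 1 ∈ S := by
        obtain ⟨e, he, h⟩ := hS _ hdS _ ((memR j).1 hj) i (by simp [Ne.symm hji])
        rcases he with rfl | ⟨l, hl, rfl⟩
        · exact h
        · have hlj : l = j := by
            by_contra hlj
            by_cases hli : l = i
            · subst hli; simp [hlj] at hl
            · simp [hli, hlj] at hl
          subst hlj
          refine absurd ?_ hno'
          convert h using 1
          abel
      obtain ⟨e, he, h⟩ := hS y hy _ hc i (by simp [Ne.symm hji])
      rcases he with rfl | ⟨l, hl, rfl⟩
      · exact absurd h hno'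
      · by_cases hlj : l = j
        · subst hlj; simp [hji] at hl
        · by_cases hli : l = i
          · subst hli; simp [hlj] at hl
          · simp [hli, hlj] at hl
    · refine ⟨m, ?_, rfl⟩
      have hmj : m ≠ j := by rintro rfl; omega
      by_cases hmi : m = i
      · rwa [hmi]
      by_contra hmR
      rw [memR] at hmR
      -- moving `y - χ_j + χ_m` towards `y - χ_i + χ_j`, and then `y` towards `y - χ_i - χ_j + χ_m`
      have hc : y - (Pi.single j 1 - Pi.single m 1) - Pi.single i 1 ∈ S := by
        obtain ⟨e, he, h⟩ := hS _ hdS _ ((memR j).1 hj) i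
          (by simp [Ne.symm hji, Ne.symm hmi])
        rcases he with rfl | ⟨l, hl, rfl⟩
        · exact h
        · have hlj : l = j := by
            by_contra hlj
            by_cases hli : l = i
            · subst hli; simp [hlj, Ne.symm hmi] at hl
            · by_cases hlm : l = m
              · subst hlm; simp [hli, hlj] at hl
              · simp [hli, hlj, hlm] at hl
          subst hlj
          refine absurd ?_ hmR
          convert h using 1
          abel
      obtain ⟨e, he, h⟩ := hS y hy _ hc i (by simp [Ne.symm hji, Ne.symm hmi])
      rcases he with rfl | ⟨l, hl, rfl⟩
      · exact hno' h
      · have hlm : l = m := by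
          by_contra hlm
          by_cases hlj : l = j
          · subst hlj; simp [hji, hlm] at hl
          · by_cases hli : l = i
            · subst hli; simp [hlj, hlm] at hl
            · simp [hli, hlj, hlm] at hl
        subst hlm
        exact hmR (by rwa [sub_add])
  have hmin : ∀ n : ℕ, ∀ z ∈ S, l1 (z - y) = n → total y R ≤ total z R := by
    intro n
    induction n using Nat.strong_induction_on with
    | _ n ih =>
    intro z hz hn
    by_contra! hlt
    obtain ⟨j, hj, hzj⟩ := Finset.exists_lt_of_sum_lt hlt
    have hzj' : 0 < (y - z) j := by simpa using hzj
    obtain ⟨d, hd, hyd⟩ := hS y hy z hz j hzj'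
    -- the exchange gives an item of `R` in which `z` exceeds `y`
    obtain ⟨m, hm, hzm⟩ : ∃ m ∈ R, 0 < (z - y) m := by
      obtain ⟨m, hm, hdm⟩ := trans j hj z d hzj' hd hyd
      rcases hd with rfl | ⟨k, hk, rfl⟩
      · have := congrFun hdm m
        by_cases hmj : m = j
        · subst hmj; simp at this
        · simp [hmj] at this
      · have hkm : k = m := by
          by_contra hkm
          have := congrFun hdm m
          simp only [Pi.sub_apply, Pi.single_apply, Ne.symm hkm, if_true, if_false] at this
          omega
        subst hkm
        refine ⟨k, hm, ?_⟩
        simp only [Pi.sub_apply] at hk ⊢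
        omega
    obtain ⟨e, he, hze⟩ := hS z hz y hy m hzm
    have hl := he.l1_lt hzm
    rw [sub_right_comm, hn] at hl
    have h1 := ih _ hl _ hze rfl
    have h2 : total (z - e) R ≤ total z R := by
      rcases he with rfl | ⟨l, -, rfl⟩
      · simp [total, Finset.sum_sub_distrib, Finset.sum_pi_single', hm]
      · simp only [total, Pi.sub_apply, Finset.sum_sub_distrib, Finset.sum_pi_single', hm]
        split_ifs <;> simp
    omega
  obtain ⟨z, hz, hzu⟩ := hX R
  have h1 := hmin _ z hz rfl
  have h2 : total u R < total y R := Finset.sum_lt_sum hRu ⟨i, hRi, hi⟩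
  omega

/-- A set `S` such that `S` and `-S` have the one-sided exchange property contains every integer
vector that no set of items separates from it. -/
theorem IsExchangeSet.mem_of_forall_total [Fintype N] [DecidableEq N] {S : Set (N → ℤ)}
    (hS : IsExchangeSet S) (hS' : IsExchangeSet {x | -x ∈ S}) {u : N → ℤ}
    (hle : ∀ X : Finset N, ∃ z ∈ S, total z X ≤ total u X)
    (hge : ∀ X : Finset N, ∃ z ∈ S, total u X ≤ total z X) : u ∈ S := by
  have hne : S.Nonempty := let ⟨z, hz, _⟩ := hle ∅; ⟨z, hz⟩
  obtain ⟨y, hy, hnear⟩ : ∃ y ∈ S, ∀ z ∈ S, l1 (y - u) ≤ l1 (z - u) := by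
    have hwf : WellFounded (fun a b : N → ℤ => l1 (a - u) < l1 (b - u)) :=
      InvImage.wf _ wellFounded_lt
    exact ⟨hwf.min S hne, hwf.min_mem S hne, fun z hz => not_lt.1 (hwf.not_lt_min S hz)⟩
  have h1 : y ≤ u := hS.le_of_nearest hy hnear hle
  have h2 : -y ≤ -u := by
    refine hS'.le_of_nearest (by simpa using hy) (fun z hz => ?_) fun X => ?_
    · have := hnear _ hz
      rw [← l1_neg (-y - -u), ← l1_neg (z - -u)]
      convert this using 2 <;> abel
    · obtain ⟨z, hz, h⟩ := hge X
      exact ⟨-z, by simpa using hz, by simpa [total] using h⟩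
  rwa [← le_antisymm h1 (neg_le_neg_iff.1 h2)]

/-! ### Demand sets and the indirect utility -/

section Bidder

variable [Fintype N] {u : N → ℤ} {f : (N → ℤ) → ℤ}

theorem demand_nonempty (hu : 0 ≤ u) (f : (N → ℤ) → ℤ) (p : N → ℤ) : (demand u f p).Nonempty :=
  Set.Nonempty.of_image ⟨_, (mu_isLeast hu f p ∅).1⟩

/-- The indirect utility `V(p) = max {f x - pᵀ x | x ∈ [0, u]}`. -/
noncomputable def indirectUtility (u : N → ℤ) (f : (N → ℤ) → ℤ) (p : N → ℤ) : ℤ :=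
  sSup ((fun x => f x - p ⬝ᵥ x) '' Set.Icc 0 u)

theorem indirectUtility_eq {p x : N → ℤ} (hx : x ∈ demand u f p) :
    indirectUtility u f p = f x - p ⬝ᵥ x :=
  IsGreatest.csSup_eq ⟨⟨x, hx.1, rfl⟩, by rintro _ ⟨y, hy, rfl⟩; exact hx.2 y hy⟩

theorem le_indirectUtility {x : N → ℤ} (hx : x ∈ Set.Icc 0 u) (f : (N → ℤ) → ℤ) (p : N → ℤ) :
    f x - p ⬝ᵥ x ≤ indirectUtility u f p := by
  obtain ⟨y, hy⟩ := demand_nonempty (hx.1.trans hx.2) f p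
  rw [indirectUtility_eq hy]
  exact hy.2 x hx

theorem mem_demand_of_le {p x : N → ℤ} (hx : x ∈ Set.Icc 0 u)
    (h : indirectUtility u f p ≤ f x - p ⬝ᵥ x) : x ∈ demand u f p :=
  ⟨hx, fun _ hy => (le_indirectUtility hy f p).trans h⟩

theorem MnatConcave.isExchangeSet_demand [DecidableEq N] (hf : MnatConcave u f) (p : N → ℤ) :
    IsExchangeSet (demand u f p) ∧ IsExchangeSet {x | -x ∈ demand u f p} := by
  have key : ∀ x ∈ demand u f p, ∀ y ∈ demand u f p, ∀ i, 0 < (x - y) i →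
      ∃ d, IsStep (x - y) i d ∧ x - d ∈ demand u f p ∧ y + d ∈ demand u f p := by
    intro x hx y hy i hi
    obtain ⟨d, hd, h⟩ := hf.exists_step hx.1 hy.1 hi
    obtain ⟨h1, h2⟩ := hd.mem_Icc hi hx.1 hy.1
    have h3 := le_indirectUtility h1 f p
    have h4 := le_indirectUtility h2 f p
    have h5 := indirectUtility_eq hx
    have h6 := indirectUtility_eq hy
    refine ⟨d, hd, mem_demand_of_le h1 ?_, mem_demand_of_le h2 ?_⟩ <;>
    · simp only [dotProduct_sub, dotProduct_add] at *
      omega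
  refine ⟨fun x hx y hy i hi => ?_, fun x hx y hy i hi => ?_⟩
  · obtain ⟨d, hd, h, -⟩ := key x hx y hy i hi
    exact ⟨d, hd, h⟩
  · have hxy : -y - -x = x - y := by abel
    obtain ⟨d, hd, -, h⟩ := key (-y) hy (-x) hx i (by rwa [hxy])
    rw [hxy] at hd
    exact ⟨d, hd, by simpa [neg_add_eq_sub] using h⟩

/-- Nearest demanded bundles `x` at `p` and `y` at `q`.  An exchange step `d` between them leaves
both demand sets, as `x - d` is nearer to `y` and `y + d` is nearer to `x`, so that by integrality
it loses at least `1` at each of the two price vectors; on the other hand it does not lower the sum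
of the valuations, so that it changes the sum of the utilities by at least `(p - q)ᵀ d`. -/
theorem MnatConcave.exists_nearest [DecidableEq N] (hf : MnatConcave u f) (hu : 0 ≤ u)
    (p q : N → ℤ) : ∃ x ∈ demand u f p, ∃ y ∈ demand u f q,
      (∀ i, 0 < (x - y) i → ∃ d, IsStep (x - y) i d ∧ (p - q) ⬝ᵥ d ≤ -2) ∧
      ∀ i, 0 < (y - x) i → ∃ d, IsStep (y - x) i d ∧ (q - p) ⬝ᵥ d ≤ -2 := by
  have hne : (demand u f p ×ˢ demand u f q).Nonempty :=
    (demand_nonempty hu f p).prod (demand_nonempty hu f q)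
  have hwf : WellFounded
      (fun a b : (N → ℤ) × (N → ℤ) => l1 (a.1 - a.2) < l1 (b.1 - b.2)) :=
    InvImage.wf _ wellFounded_lt
  obtain ⟨⟨x, y⟩, ⟨hx, hy⟩, hnear⟩ :
      ∃ a ∈ demand u f p ×ˢ demand u f q, ∀ b ∈ demand u f p ×ˢ demand u f q,
        l1 (a.1 - a.2) ≤ l1 (b.1 - b.2) :=
    ⟨hwf.min _ hne, hwf.min_mem _ hne, fun z hz => not_lt.1 (hwf.not_lt_min _ hz)⟩
  have key : ∀ (p q x y : N → ℤ), x ∈ demand u f p → y ∈ demand u f q →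
      (∀ x' ∈ demand u f p, ∀ y' ∈ demand u f q, l1 (x - y) ≤ l1 (x' - y')) →
      ∀ i, 0 < (x - y) i → ∃ d, IsStep (x - y) i d ∧ (p - q) ⬝ᵥ d ≤ -2 := by
    intro p q x y hx hy hnear i hi
    obtain ⟨d, hd, h⟩ := hf.exists_step hx.1 hy.1 hi
    obtain ⟨h1, h2⟩ := hd.mem_Icc hi hx.1 hy.1
    have hl := hd.l1_lt hi
    have h3 : f (x - d) - p ⬝ᵥ (x - d) < indirectUtility u f p := by
      by_contra! hc
      have := hnear _ (mem_demand_of_le h1 hc) y hy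
      rw [sub_right_comm] at this
      omega
    have h4 : f (y + d) - q ⬝ᵥ (y + d) < indirectUtility u f q := by
      by_contra! hc
      have := hnear x hx _ (mem_demand_of_le h2 hc)
      rw [← sub_sub] at this
      omega
    rw [indirectUtility_eq hx] at h3
    rw [indirectUtility_eq hy] at h4
    refine ⟨d, hd, ?_⟩
    simp only [dotProduct_sub, dotProduct_add, sub_dotProduct] at *
    omega
  refine ⟨x, hx, y, hy, key p q x y hx hy fun x' hx' y' hy' => hnear (x', y') ⟨hx', hy'⟩,
    key q p y x hy hx fun y' hy' x' hx' => ?_⟩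
  have := hnear (x', y') ⟨hx', hy'⟩
  rw [← l1_neg (y - x), ← l1_neg (y' - x'), neg_sub, neg_sub]
  exact this

/-- Price vectors that differ by a `0`-`1` vector have a commonly demanded bundle. -/
theorem MnatConcave.exists_mem_demand_inter [DecidableEq N] (hf : MnatConcave u f) (hu : 0 ≤ u)
    {p q : N → ℤ} (hpq : p ≤ q) (hqp : q ≤ p + 1) :
    ∃ x, x ∈ demand u f p ∧ x ∈ demand u f q := by
  obtain ⟨x, hx, y, hy, h1, h2⟩ := hf.exists_nearest hu p q
  have hp : ∀ i, p i ≤ q i ∧ q i ≤ p i + 1 := fun i => ⟨hpq i, hqp i⟩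
  suffices x = y by subst this; exact ⟨x, hx, hy⟩
  funext i
  rcases lt_trichotomy (x i) (y i) with h | h | h
  · obtain ⟨d, hd, hle⟩ := h2 i (by simpa using h)
    have := hp i
    rcases hd with rfl | ⟨k, -, rfl⟩
    · simp at hle; omega
    · have := hp k
      simp [dotProduct_sub] at hle; omega
  · exact h
  · obtain ⟨d, hd, hle⟩ := h1 i (by simpa using h)
    have := hp i
    rcases hd with rfl | ⟨k, -, rfl⟩
    · simp at hle; omega
    · have := hp k
      simp [dotProduct_sub] at hle; omega

/-- Raising the prices in `X` by one lowers the indirect utility by exactly `μ(X; p)`. -/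
theorem MnatConcave.indirectUtility_add_chi [DecidableEq N] (hf : MnatConcave u f) (hu : 0 ≤ u)
    (p : N → ℤ) (X : Finset N) :
    indirectUtility u f (p + chi X) = indirectUtility u f p - mu u f p X := by
  obtain ⟨x, hx, hx'⟩ := hf.exists_mem_demand_inter hu (p := p) (q := p + chi X)
    (le_add_of_nonneg_right (chi_nonneg X)) (by gcongr; exact chi_le_one X)
  have hmu : mu u f p X = total x X := by
    refine (mu_isLeast hu f p X).unique ⟨⟨x, hx, rfl⟩, ?_⟩
    rintro _ ⟨y, hy, rfl⟩
    have h1 := hx'.2 y hy.1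
    have h2 := hy.2 x hx.1
    simp only [add_dotProduct, chi_dotProduct] at *
    omega
  rw [indirectUtility_eq hx, indirectUtility_eq hx', hmu, add_dotProduct, chi_dotProduct]
  ring

theorem MnatConcave.indirectUtility_sup_add_inf_le [DecidableEq N] (hf : MnatConcave u f)
    (hu : 0 ≤ u) {p q : N → ℤ} (h : p ⊔ q ≤ p ⊓ q + 1) :
    indirectUtility u f (p ⊔ q) + indirectUtility u f (p ⊓ q) ≤
      indirectUtility u f p + indirectUtility u f q := by
  obtain ⟨x, hx, hx'⟩ := hf.exists_mem_demand_inter hu inf_le_sup h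
  have h1 := le_indirectUtility hx.1 f p
  have h2 := le_indirectUtility hx.1 f q
  have h3 : (p ⊔ q) ⬝ᵥ x + (p ⊓ q) ⬝ᵥ x = p ⬝ᵥ x + q ⬝ᵥ x := by
    rw [← add_dotProduct, ← add_dotProduct, add_comm, inf_add_sup]
  rw [indirectUtility_eq hx, indirectUtility_eq hx']
  omega

/-- The instance of translation submodularity in which `p` and `q` are brought closer together on
the set of items where `q - p` is largest. -/
theorem MnatConcave.indirectUtility_add_sub_le [DecidableEq N] (hf : MnatConcave u f)
    (hu : 0 ≤ u) {p q : N → ℤ} {X : Finset N} {a : ℤ} (ha : 0 < a)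
    (hX : ∀ i ∈ X, q i - p i = a) (hX' : ∀ i ∉ X, q i - p i < a) :
    indirectUtility u f (p + chi X) + indirectUtility u f (q - chi X) ≤
      indirectUtility u f p + indirectUtility u f q := by
  obtain ⟨x, hx, y, hy, -, h2⟩ := hf.exists_nearest hu (p + chi X) (q - chi X)
  have hxy : total y X ≤ total x X := by
    refine Finset.sum_le_sum fun i hi => ?_
    by_contra! hlt
    obtain ⟨d, hd, hle⟩ := h2 i (by simpa using hlt)
    have hai := hX i hi
    rcases hd with rfl | ⟨k, -, rfl⟩
    · simp [chi_apply, hi] at hle; omega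
    · by_cases hk : k ∈ X
      · have := hX k hk
        simp [dotProduct_sub, chi_apply, hi, hk] at hle; omega
      · have := hX' k hk
        simp [dotProduct_sub, chi_apply, hi, hk] at hle; omega
  have h3 := le_indirectUtility hx.1 f p
  have h4 := le_indirectUtility hy.1 f q
  rw [indirectUtility_eq hx, indirectUtility_eq hy, add_dotProduct, sub_dotProduct,
    chi_dotProduct, chi_dotProduct]
  omega

/-- An item with a negative price may be demanded in full by a monotone bidder. -/
theorem indirectUtility_sup_zero_le (hu : 0 ≤ u) (hmono : MonotoneOn f (Set.Icc 0 u))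
    (p : N → ℤ) :
    indirectUtility u f (p ⊔ 0) + (p ⊔ 0 - p) ⬝ᵥ u ≤ indirectUtility u f p := by
  obtain ⟨x, hx⟩ := demand_nonempty hu f (p ⊔ 0)
  set y : N → ℤ := fun i => if p i < 0 then u i else x i with hy
  have hxy : x ≤ y := fun i => by
    have := hx.1.2 i
    simp only [hy]; split_ifs <;> simp_all
  have hy' : y ∈ Set.Icc 0 u := ⟨hx.1.1.trans hxy, fun i => by
    have := hx.1.2 i
    simp only [hy]; split_ifs <;> simp_all⟩
  have h1 := le_indirectUtility hy' f p
  have h2 := hmono hx.1 hy' hxy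
  have h3 : p ⬝ᵥ y = (p ⊔ 0) ⬝ᵥ x - (p ⊔ 0 - p) ⬝ᵥ u := by
    rw [dotProduct, dotProduct, dotProduct, ← Finset.sum_sub_distrib]
    refine Finset.sum_congr rfl fun i _ => ?_
    simp only [hy, Pi.sup_apply, Pi.zero_apply, Pi.sub_apply]
    split_ifs with h
    · rw [max_eq_right h.le]; ring
    · rw [max_eq_left (not_lt.1 h)]; ring
  rw [indirectUtility_eq hx]
  omega

end Bidder

/-! ### The Lyapunov function -/

section Lyapunov

variable [Fintype N] [Fintype M] {u : N → ℤ} {v : M → (N → ℤ) → ℤ}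

/-- The Lyapunov function `L(p) = ∑_b V_b(p) + pᵀ u` of the auction. -/
noncomputable def lyapunov (u : N → ℤ) (v : M → (N → ℤ) → ℤ) (p : N → ℤ) : ℤ :=
  ∑ b, indirectUtility u (v b) p + p ⬝ᵥ u

/-- Weak duality: the welfare of an allocation of `u` is a lower bound of the Lyapunov function. -/
theorem sum_le_lyapunov {x : M → N → ℤ} (hx : ∀ b, x b ∈ Set.Icc 0 u) (hsum : ∑ b, x b = u)
    (p : N → ℤ) : ∑ b, v b (x b) ≤ lyapunov u v p := by
  have h : ∑ b, (v b (x b) - p ⬝ᵥ x b) ≤ ∑ b, indirectUtility u (v b) p :=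
    Finset.sum_le_sum fun b _ => le_indirectUtility (hx b) (v b) p
  rw [Finset.sum_sub_distrib, ← dotProduct_sum, hsum] at h
  unfold lyapunov
  omega

theorem exists_le_lyapunov [Nonempty M] (hu : 0 ≤ u) (v : M → (N → ℤ) → ℤ) :
    ∃ c, ∀ p, c ≤ lyapunov u v p := by
  classical
  let b₀ : M := Classical.arbitrary M
  refine ⟨_, sum_le_lyapunov (x := Pi.single b₀ u) (fun b => ?_) (by simp)⟩
  by_cases hb : b = b₀
  · subst hb; simpa using hu
  · simpa [hb] using hu

theorem lyapunov_sup_zero_le [Nonempty M] (hu : 0 ≤ u)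
    (hmono : ∀ b, MonotoneOn (v b) (Set.Icc 0 u)) (p : N → ℤ) :
    lyapunov u v (p ⊔ 0) ≤ lyapunov u v p := by
  have h : ∑ b, (indirectUtility u (v b) (p ⊔ 0) + (p ⊔ 0 - p) ⬝ᵥ u) ≤
      ∑ b, indirectUtility u (v b) p :=
    Finset.sum_le_sum fun b _ => indirectUtility_sup_zero_le hu (hmono b) p
  rw [Finset.sum_add_distrib, Finset.sum_const, Finset.card_univ, nsmul_eq_mul] at h
  have h0 : 0 ≤ (p ⊔ 0 - p) ⬝ᵥ u :=
    dotProduct_nonneg_of_nonneg (sub_nonneg.2 le_sup_left) hu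
  have h1 : (1 : ℤ) ≤ Fintype.card M := by exact_mod_cast Fintype.card_pos
  have h2 := le_mul_of_one_le_left h0 h1
  have h3 : (p ⊔ 0 - p) ⬝ᵥ u = (p ⊔ 0) ⬝ᵥ u - p ⬝ᵥ u := sub_dotProduct ..
  unfold lyapunov
  omega

variable [DecidableEq N]

theorem lyapunov_add_chi (hu : 0 ≤ u) (hconc : ∀ b, MnatConcave u (v b)) (p : N → ℤ)
    (X : Finset N) : lyapunov u v (p + chi X) = lyapunov u v p - deficiency u v p X := by
  simp only [lyapunov, deficiency, (hconc _).indirectUtility_add_chi hu, Finset.sum_sub_distrib,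
    add_dotProduct, chi_dotProduct]
  ring

omit [DecidableEq N] in
/-- Local submodularity extends to all of `ℤ^N` by splitting the two increments. -/
theorem submodular_of_local {g : (N → ℤ) → ℤ}
    (hg : ∀ p q : N → ℤ, p ⊔ q ≤ p ⊓ q + 1 → g (p ⊔ q) + g (p ⊓ q) ≤ g p + g q) (p q : N → ℤ) :
    g (p ⊔ q) + g (p ⊓ q) ≤ g p + g q := by
  have base : ∀ a s t : N → ℤ, 0 ≤ s → 0 ≤ t → (∀ i, s i = 0 ∨ t i = 0) → s ≤ 1 → t ≤ 1 →
      g (a + s + t) + g a ≤ g (a + s) + g (a + t) := by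
    intro a s t hs ht hst hs1 ht1
    have h1 : (a + s) ⊔ (a + t) = a + s + t := by
      funext i
      have := hs i; have := ht i; have := hst i
      simp at *; omega
    have h2 : (a + s) ⊓ (a + t) = a := by
      funext i
      have := hs i; have := ht i; have := hst i
      simp at *; omega
    have := hg (a + s) (a + t) (by
      rw [h1, h2]
      intro i
      have := hs1 i; have := ht1 i; have := hst i
      simp at *; omega)
    rwa [h1, h2] at this
  have split_right : ∀ (n : ℕ) (a s t : N → ℤ), 0 ≤ s → 0 ≤ t → (∀ i, s i = 0 ∨ t i = 0) → s ≤ 1 →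
      (∀ i, t i ≤ n) → g (a + s + t) + g a ≤ g (a + s) + g (a + t) := by
    intro n
    induction n with
    | zero =>
      intro a s t hs ht hst hs1 htn
      exact base a s t hs ht hst hs1 fun i => (htn i).trans (by simp)
    | succ n ih =>
      intro a s t hs ht hst hs1 htn
      have h1 := base a s (t ⊓ 1) hs (le_inf ht zero_le_one)
        (fun i => by have := ht i; have := hst i; simp at *; omega) hs1 inf_le_right
      have h2 := ih (a + t ⊓ 1) s (t - t ⊓ 1) hs (sub_nonneg.2 inf_le_left)
        (fun i => by have := ht i; have := hst i; simp at *; omega) hs1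
        (fun i => by have := ht i; have := htn i; simp at *; omega)
      rw [show a + t ⊓ 1 + s + (t - t ⊓ 1) = a + s + t by abel,
        show a + t ⊓ 1 + (t - t ⊓ 1) = a + t by abel, add_right_comm a (t ⊓ 1) s] at h2
      omega
  have split_both : ∀ (m n : ℕ) (a s t : N → ℤ), 0 ≤ s → 0 ≤ t → (∀ i, s i = 0 ∨ t i = 0) →
      (∀ i, s i ≤ m) → (∀ i, t i ≤ n) → g (a + s + t) + g a ≤ g (a + s) + g (a + t) := by
    intro m n
    induction m with
    | zero =>
      intro a s t hs ht hst hsm htn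
      exact split_right n a s t hs ht hst (fun i => (hsm i).trans (by simp)) htn
    | succ m ih =>
      intro a s t hs ht hst hsm htn
      have h1 := split_right n a (s ⊓ 1) t (le_inf hs zero_le_one) ht
        (fun i => by have := hs i; have := hst i; simp at *; omega) inf_le_right htn
      have h2 := ih (a + s ⊓ 1) (s - s ⊓ 1) t (sub_nonneg.2 inf_le_left) ht
        (fun i => by have := hs i; have := hst i; simp at *; omega)
        (fun i => by have := hs i; have := hsm i; simp at *; omega) htn
      rw [show a + s ⊓ 1 + (s - s ⊓ 1) = a + s by abel] at h2
      omega
  have bound : ∀ z : N → ℤ, 0 ≤ z → ∀ i, z i ≤ (l1 z : ℕ) := by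
    intro z hz i
    have : (z i).natAbs ≤ l1 z :=
      Finset.single_le_sum (f := fun i => (z i).natAbs) (fun _ _ => Nat.zero_le _)
        (Finset.mem_univ i)
    have := hz i
    simp at this
    omega
  have hp : 0 ≤ p - p ⊓ q := sub_nonneg.2 inf_le_left
  have hq : 0 ≤ q - p ⊓ q := sub_nonneg.2 inf_le_right
  have := split_both _ _ (p ⊓ q) _ _ hp hq (fun i => by simp; omega) (bound _ hp) (bound _ hq)
  rw [add_sub_cancel, add_sub_cancel,
    show p + (q - p ⊓ q) = p ⊔ q by
      rw [← add_sub_assoc, ← inf_add_sup p q, add_sub_cancel_left]] at this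
  exact this

theorem lyapunov_submodular (hu : 0 ≤ u) (hconc : ∀ b, MnatConcave u (v b)) (p q : N → ℤ) :
    lyapunov u v (p ⊔ q) + lyapunov u v (p ⊓ q) ≤ lyapunov u v p + lyapunov u v q := by
  refine submodular_of_local (fun p q h => ?_) p q
  have h1 : ∑ b, (indirectUtility u (v b) (p ⊔ q) + indirectUtility u (v b) (p ⊓ q)) ≤
      ∑ b, (indirectUtility u (v b) p + indirectUtility u (v b) q) :=
    Finset.sum_le_sum fun b _ => (hconc b).indirectUtility_sup_add_inf_le hu h
  have h2 : (p ⊔ q) ⬝ᵥ u + (p ⊓ q) ⬝ᵥ u = p ⬝ᵥ u + q ⬝ᵥ u := by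
    rw [← add_dotProduct, ← add_dotProduct, add_comm, inf_add_sup]
  rw [Finset.sum_add_distrib, Finset.sum_add_distrib] at h1
  unfold lyapunov
  omega

/-- A price vector `p` at which no increase by a characteristic vector pays off minimizes the
Lyapunov function among all `q ≥ p`: lowering `q` on the set where `q - p` is largest does not
increase the function. -/
theorem lyapunov_le_of_forall_le_add_chi (hu : 0 ≤ u) (hconc : ∀ b, MnatConcave u (v b))
    {p : N → ℤ} (hp : ∀ X, lyapunov u v p ≤ lyapunov u v (p + chi X)) {q : N → ℤ} (hpq : p ≤ q) :
    lyapunov u v p ≤ lyapunov u v q := by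
  have main : ∀ n : ℕ, ∀ q, p ≤ q → l1 (q - p) = n → lyapunov u v p ≤ lyapunov u v q := by
    intro n
    induction n using Nat.strong_induction_on with
    | _ n ih =>
    intro q hpq hn
    by_cases hne : p = q
    · rw [hne]
    obtain ⟨j, hj⟩ := Function.ne_iff.1 hne
    have hpj : p j < q j := lt_of_le_of_ne (hpq j) hj
    obtain ⟨m, -, hm⟩ := Finset.exists_max_image Finset.univ (fun i => q i - p i) ⟨j, by simp⟩
    have ha : 0 < q m - p m := by have := hm j (Finset.mem_univ j); omega
    set X : Finset N := Finset.univ.filter fun i => q i - p i = q m - p m with hX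
    have hX1 : ∀ i ∈ X, q i - p i = q m - p m := fun i hi => by simpa [hX] using hi
    have hX2 : ∀ i ∉ X, q i - p i < q m - p m := fun i hi =>
      lt_of_le_of_ne (hm i (Finset.mem_univ i)) (by simpa [hX] using hi)
    have h1 : ∑ b, (indirectUtility u (v b) (p + chi X) + indirectUtility u (v b) (q - chi X)) ≤
        ∑ b, (indirectUtility u (v b) p + indirectUtility u (v b) q) :=
      Finset.sum_le_sum fun b _ => (hconc b).indirectUtility_add_sub_le hu ha hX1 hX2
    rw [Finset.sum_add_distrib, Finset.sum_add_distrib] at h1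
    have h2 : lyapunov u v (p + chi X) + lyapunov u v (q - chi X) ≤
        lyapunov u v p + lyapunov u v q := by
      simp only [lyapunov, add_dotProduct, sub_dotProduct]
      omega
    have h3 : p ≤ q - chi X := by
      intro i
      have := hpq i
      by_cases hi : i ∈ X
      · have := hX1 i hi
        simp [chi_apply, hi]; omega
      · simp [chi_apply, hi]; omega
    have h4 : l1 (q - chi X - p) < n := by
      rw [← hn]
      refine Finset.sum_lt_sum (fun i _ => ?_) ⟨m, Finset.mem_univ m, ?_⟩
      · have h5 := h3 i
        have h6 := chi_nonneg X i
        simp only [Pi.sub_apply, Pi.zero_apply] at *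
        omega
      · have : m ∈ X := by simp [hX]
        simp [chi_apply, this]
        omega
    have h5 := ih _ h4 _ h3 rfl
    have h6 := hp X
    omega
  exact main _ q hpq rfl

/-- The equilibrium price vectors are the nonnegative minimizers of the Lyapunov function. -/
theorem isEquilibriumPrice_iff (hu : 0 ≤ u) (hconc : ∀ b, MnatConcave u (v b)) (p : N → ℤ) :
    IsEquilibriumPrice u v p ↔ 0 ≤ p ∧ ∀ q, lyapunov u v p ≤ lyapunov u v q := by
  refine and_congr_right fun _ => ⟨?_, fun hmin => ?_⟩
  · rintro ⟨x, hsum, hx⟩ q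
    refine le_trans (le_of_eq ?_) (sum_le_lyapunov (fun b => (hx b).1) hsum q)
    simp only [lyapunov, indirectUtility_eq (hx _), Finset.sum_sub_distrib]
    rw [← dotProduct_sum, hsum]
    ring
  · have hneg : IsExchangeSet
        {w | -w ∈ {w | ∃ x : M → N → ℤ, ∑ b, x b = w ∧ ∀ b, x b ∈ demand u (v b) p}} := by
      convert IsExchangeSet.sum fun b => ((hconc b).isExchangeSet_demand p).2 using 1
      ext w
      constructor
      · rintro ⟨x, hx, hxD⟩
        exact ⟨-x, by simp [hx], by simpa using hxD⟩
      · rintro ⟨x, hx, hxD⟩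
        exact ⟨-x, by simp [hx], hxD⟩
    -- the aggregate demand set is an exchange set that no set of items separates from `u`
    refine (IsExchangeSet.sum fun b => ((hconc b).isExchangeSet_demand p).1).mem_of_forall_total
      hneg (fun X => ?_) fun X => ?_
    · choose x hx hx' using fun b => (hconc b).exists_mem_demand_inter hu (p := p)
        (q := p + chi X) (le_add_of_nonneg_right (chi_nonneg X)) (by gcongr; exact chi_le_one X)
      refine ⟨_, ⟨x, rfl, hx⟩, ?_⟩
      have h := hmin (p + chi X)
      simp only [lyapunov, indirectUtility_eq (hx _), indirectUtility_eq (hx' _),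
        Finset.sum_sub_distrib, add_dotProduct, Finset.sum_add_distrib,
        chi_dotProduct] at h
      rw [total_sum]
      omega
    · choose x hx hx' using fun b => (hconc b).exists_mem_demand_inter hu (p := p - chi X)
        (q := p) (sub_le_self _ (chi_nonneg X)) (by
          intro i
          have := chi_le_one X i
          simp at *; omega)
      refine ⟨_, ⟨x, rfl, hx'⟩, ?_⟩
      have h := hmin (p - chi X)
      simp only [lyapunov, indirectUtility_eq (hx _), indirectUtility_eq (hx' _),
        Finset.sum_sub_distrib, sub_dotProduct, chi_dotProduct] at h
      rw [total_sum]
      omega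

theorem exists_isLeast_isEquilibriumPrice [Nonempty M] (hu : 0 ≤ u)
    (hmono : ∀ b, MonotoneOn (v b) (Set.Icc 0 u)) (hconc : ∀ b, MnatConcave u (v b)) :
    ∃ r, IsLeast {p | IsEquilibriumPrice u v p} r := by
  obtain ⟨c, hc⟩ := exists_le_lyapunov hu v
  obtain ⟨_, ⟨p, rfl⟩, hp⟩ := Int.exists_least_of_bdd (P := fun z => ∃ p, lyapunov u v p = z)
    ⟨c, by rintro _ ⟨p, rfl⟩; exact hc p⟩ ⟨_, 0, rfl⟩
  have hE : (p ⊔ 0) ∈ {p | IsEquilibriumPrice u v p} :=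
    (isEquilibriumPrice_iff hu hconc _).2 ⟨le_sup_right, fun q =>
      (lyapunov_sup_zero_le hu hmono p).trans (hp _ ⟨q, rfl⟩)⟩
  have hwf : WellFounded (fun a b : N → ℤ => l1 a < l1 b) := InvImage.wf _ wellFounded_lt
  obtain ⟨r, hr, hrmin⟩ : ∃ r, IsEquilibriumPrice u v r ∧
      ∀ q, IsEquilibriumPrice u v q → l1 r ≤ l1 q :=
    ⟨hwf.min _ ⟨_, hE⟩, hwf.min_mem _ ⟨_, hE⟩, fun q hq => not_lt.1 (hwf.not_lt_min _ hq)⟩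
  refine ⟨r, hr, fun q hq => ?_⟩
  have hr' := (isEquilibriumPrice_iff hu hconc _).1 hr
  have hq' := (isEquilibriumPrice_iff hu hconc _).1 hq
  have hinf : IsEquilibriumPrice u v (r ⊓ q) := by
    refine (isEquilibriumPrice_iff hu hconc _).2 ⟨le_inf hr'.1 hq'.1, fun z => ?_⟩
    have h1 := lyapunov_submodular hu hconc r q
    have h2 := hq'.2 (r ⊔ q)
    have h3 := hr'.2 z
    omega
  intro i
  by_contra! hlt
  have : l1 (r ⊓ q) < l1 r := by
    refine Finset.sum_lt_sum (fun j _ => ?_) ⟨i, Finset.mem_univ i, ?_⟩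
    · have := hr'.1 j; have := hq'.1 j
      simp at *; omega
    · have := hr'.1 i; have := hq'.1 i
      simp at *; omega
  have := hrmin _ hinf
  omega

/-! ### The ascending auction -/

theorem deficiency_supermodular (hu : 0 ≤ u) (hconc : ∀ b, MnatConcave u (v b)) (p : N → ℤ)
    (X Y : Finset N) :
    deficiency u v p X + deficiency u v p Y ≤
      deficiency u v p (X ∪ Y) + deficiency u v p (X ∩ Y) := by
  have h := lyapunov_submodular hu hconc (p + chi X) (p + chi Y)
  have h1 : (p + chi X) ⊔ (p + chi Y) = p + chi (X ∪ Y) := by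
    funext i
    by_cases hX : i ∈ X <;> by_cases hY : i ∈ Y <;> simp [chi_apply, hX, hY]
  have h2 : (p + chi X) ⊓ (p + chi Y) = p + chi (X ∩ Y) := by
    funext i
    by_cases hX : i ∈ X <;> by_cases hY : i ∈ Y <;> simp [chi_apply, hX, hY]
  simp only [h1, h2, lyapunov_add_chi hu hconc] at h
  omega

theorem existsUnique_minimalMaximizer (hu : 0 ≤ u) (hconc : ∀ b, MnatConcave u (v b))
    (p : N → ℤ) : ∃! X, MinimalMaximizer u v p X := by
  obtain ⟨Y, -, hY⟩ := Finset.exists_max_image Finset.univ (deficiency u v p) ⟨∅, by simp⟩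
  obtain ⟨X, -, hX⟩ := exists_minimal_le_of_wellFoundedLT
    (fun Y => ∀ Z, deficiency u v p Z ≤ deficiency u v p Y) Y fun Z => hY Z (by simp)
  have key : ∀ A B, MinimalMaximizer u v p A → MinimalMaximizer u v p B → A ⊆ B := by
    intro A B hA hB
    refine (hA.2 (y := A ∩ B) (fun Z => ?_) Finset.inter_subset_left).trans
      Finset.inter_subset_right
    have h1 := deficiency_supermodular hu hconc p A B
    have h2 := hB.1 (A ∪ B)
    have h3 := hA.1 Z
    omega
  exact ⟨X, hX, fun Z hZ => (key Z X hZ hX).antisymm (key X Z hX hZ)⟩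

omit [DecidableEq N] in
theorem overdemanded_iff {p : N → ℤ} {X : Finset N} :
    Overdemanded u v p X ↔ 0 < deficiency u v p X := by
  unfold Overdemanded deficiency
  omega

/-- Below a minimizer `r` of the Lyapunov function, removing from `X` the items whose prices have
reached `r` does not decrease the deficiency. -/
theorem deficiency_le_filter (hu : 0 ≤ u) (hconc : ∀ b, MnatConcave u (v b)) {p r : N → ℤ}
    (hr : ∀ q, lyapunov u v r ≤ lyapunov u v q) (hpr : p ≤ r) (X : Finset N) :
    deficiency u v p X ≤ deficiency u v p (X.filter fun i => p i < r i) := by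
  have h := lyapunov_submodular hu hconc (p + chi X) r
  have h1 : (p + chi X) ⊓ r = p + chi (X.filter fun i => p i < r i) := by
    funext i
    have hi : p i ≤ r i := hpr i
    simp only [Pi.inf_apply, Pi.add_apply, chi_apply, Finset.mem_filter]
    by_cases hX : i ∈ X
    · by_cases hY : p i < r i
      · simp only [hX, hY, and_self, if_true]
        exact min_eq_left hY
      · simp only [hX, hY, and_false, if_true, if_false]
        rw [min_eq_right (by omega)]
        omega
    · simp [hX, hi]
  have h2 := hr ((p + chi X) ⊔ r)
  simp only [h1, lyapunov_add_chi hu hconc] at h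
  omega

/-- The auction finds the least equilibrium price vector under every selection rule that allows
only minimal overdemanded sets and minimal maximizers, and that never gets stuck. -/
theorem auctionFinds_of_rule [Nonempty M] (hu : 0 ≤ u) (hconc : ∀ b, MnatConcave u (v b))
    {r : N → ℤ} (hr : IsLeast {p | IsEquilibriumPrice u v p} r)
    {rule : (N → ℤ) → Finset N → Prop}
    (hrule : ∀ p X, rule p X → MinimalOverdemanded u v p X ∨ MinimalMaximizer u v p X)
    (hex : ∀ p, (∃ X, Overdemanded u v p X) → ∃ X, Overdemanded u v p X ∧ rule p X)
    {p₀ : N → ℤ} (hp₀ : 0 ≤ p₀) (hp₀r : p₀ ≤ r) : AuctionFinds u v rule p₀ r := by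
  have hmin := ((isEquilibriumPrice_iff hu hconc r).1 hr.1).2
  refine ⟨?_, fun q hq => ⟨hex q, fun hnot => ?_⟩⟩
  · -- the Lyapunov function is bounded below and drops in every iteration
    rintro ⟨s, -, hs⟩
    obtain ⟨c, hc⟩ := exists_le_lyapunov hu v
    have hdec : ∀ t : ℕ, lyapunov u v (s t) ≤ lyapunov u v (s 0) - t := by
      intro t
      induction t with
      | zero => simp
      | succ t ih =>
        obtain ⟨X, hX, -, hq⟩ := hs t
        rw [hq, lyapunov_add_chi hu hconc]
        have := overdemanded_iff.1 hX
        push_cast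
        omega
    have h1 := hdec (lyapunov u v (s 0) - c + 1).toNat
    have h2 := hc (s (lyapunov u v (s 0) - c + 1).toNat)
    have h3 := hc (s 0)
    omega
  · have hinv : 0 ≤ q ∧ q ≤ r := by
      clear hnot
      induction hq with
      | refl => exact ⟨hp₀, hp₀r⟩
      | @tail p q _ hstep ih =>
        obtain ⟨X, hX, hXr, rfl⟩ := hstep
        refine ⟨add_nonneg ih.1 (chi_nonneg X), fun i => ?_⟩
        have hle := deficiency_le_filter hu hconc hmin ih.2 X
        have hsub : X ⊆ X.filter fun i => p i < r i := by
          rcases hrule p X hXr with h | h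
          · exact h.2 (overdemanded_iff.2 ((overdemanded_iff.1 hX).trans_le hle))
              (Finset.filter_subset _ _)
          · exact h.2 (fun Z => (h.1 Z).trans hle) (Finset.filter_subset _ _)
        by_cases hi : i ∈ X
        · have := (Finset.mem_filter.1 (hsub hi)).2
          simp [chi_apply, hi]; omega
        · simpa [chi_apply, hi] using ih.2 i
    have hup : lyapunov u v q ≤ lyapunov u v r :=
      lyapunov_le_of_forall_le_add_chi hu hconc (fun X => by
        rw [lyapunov_add_chi hu hconc]
        have : ¬ Overdemanded u v q X := fun h => hnot ⟨X, h⟩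
        rw [overdemanded_iff] at this
        omega) hinv.2
    exact hinv.2.antisymm (hr.2 ((isEquilibriumPrice_iff hu hconc q).2
      ⟨hinv.1, fun z => hup.trans (hmin z)⟩))

omit [DecidableEq N] in
theorem exists_minimalOverdemanded {p : N → ℤ} (h : ∃ X, Overdemanded u v p X) :
    ∃ X, Overdemanded u v p X ∧ MinimalOverdemanded u v p X := by
  obtain ⟨Y, hY⟩ := h
  obtain ⟨X, -, hX⟩ := exists_minimal_le_of_wellFoundedLT (Overdemanded u v p) Y hY
  exact ⟨X, hX.1, hX⟩

theorem exists_overdemanded_minimalMaximizer (hu : 0 ≤ u) (hconc : ∀ b, MnatConcave u (v b))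
    {p : N → ℤ} (h : ∃ X, Overdemanded u v p X) :
    ∃ X, Overdemanded u v p X ∧ MinimalMaximizer u v p X := by
  obtain ⟨Y, hY⟩ := h
  obtain ⟨X, hX, -⟩ := existsUnique_minimalMaximizer hu hconc p
  exact ⟨X, overdemanded_iff.2 ((overdemanded_iff.1 hY).trans_le (hX.1 Y)), hX⟩

end Lyapunov

end MultiDemand

theorem mainTheorem2 {N M : Type*} [Fintype N] [DecidableEq N] [Fintype M] [Nonempty M]
    (u : N → ℤ) (hu : ∀ i, 0 < u i)
    (v : M → (N → ℤ) → ℤ)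
    (hzero : ∀ b, v b 0 = 0)
    (hmono : ∀ b, MonotoneOn (v b) (Set.Icc 0 u))
    (hconc : ∀ b, MultiDemand.MnatConcave u (v b)) :
    (∀ p : N → ℤ, 0 ≤ p → ∃! X : Finset N, MultiDemand.MinimalMaximizer u v p X) ∧
    ∃ pmin : N → ℤ,
      IsLeast {p | MultiDemand.IsEquilibriumPrice u v p} pmin ∧
      ∀ p₀ : N → ℤ, 0 ≤ p₀ → p₀ ≤ pmin →
        MultiDemand.AuctionFinds u v (MultiDemand.MinimalOverdemanded u v) p₀ pmin ∧
        MultiDemand.AuctionFinds u v (MultiDemand.MinimalMaximizer u v) p₀ pmin ∧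
        MultiDemand.AuctionFinds u v
          (fun p X => MultiDemand.MinimalOverdemanded u v p X ∨
            MultiDemand.MinimalMaximizer u v p X) p₀ pmin := by
  have hu₀ : 0 ≤ u := fun i => (hu i).le
  obtain ⟨r, hr⟩ := MultiDemand.exists_isLeast_isEquilibriumPrice hu₀ hmono hconc
  refine ⟨fun p _ => MultiDemand.existsUnique_minimalMaximizer hu₀ hconc p, r, hr,
    fun p₀ hp₀ hp₀r => ⟨?_, ?_, ?_⟩⟩
  · exact MultiDemand.auctionFinds_of_rule hu₀ hconc hr (fun _ _ h => Or.inl h)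
      (fun _ h => MultiDemand.exists_minimalOverdemanded h) hp₀ hp₀r
  · exact MultiDemand.auctionFinds_of_rule hu₀ hconc hr (fun _ _ h => Or.inr h)
      (fun _ h => MultiDemand.exists_overdemanded_minimalMaximizer hu₀ hconc h) hp₀ hp₀r
  · refine MultiDemand.auctionFinds_of_rule hu₀ hconc hr (fun _ _ h => h) (fun _ h => ?_) hp₀ hp₀r
    obtain ⟨X, hX, hX'⟩ := MultiDemand.exists_minimalOverdemanded h
    exact ⟨X, hX, Or.inl hX'⟩
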